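/- Let $A$ be an associative ring with unit, let $n\ge 0$ be an integer, and let $D(A)$ be the (unbounded) derived category of the category of left $A$-modules. Let $T$ be a (not necessarily classical) $n$-tilting left $A$-module, that is: - $T$ has projective dimension at most $n$, i.e. there is an exact sequence $0\to P_n\to\cdots\to P_1\to P_0\to T\to 0$ with all $P_i$ projective; - $\operatorname{Ext}^i_A(T,T^{(\Lambda)})=0$ for every $0<i\le n$ and every set $\Lambda$, where $T^{(\Lambda)}$ is the direct sum of copies of $T$ indexed by $\Lambda$; - $T$ is a generator of $D(A)$: if $X\in D(A)$ satisfies $\operatorname{Hom}_{D(A)}(T,X[i])=0$ for every $i\in\mathbb Z$, then $X=0$ in $D(A)$. For $k\in\mathbb Z$ let $$\mathcal D^{\le k}=\{X\in D(A): H^i(X)=0\text{ for all } i>k\},\qquad \mathcal D^{\ge k}=\{X\in D(A): H^i(X)=0\text{ for all } i<k\}$$ be the subcategories given by the natural $t$-structure, and let the aisle and the coaisle associated with $T$ be $$\mathcal T^{\le 0}=\{X\in D(A): \operatorname{Hom}_{D(A)}(T,X[i])=0\text{ for all } i>0\},\qquad \mathcal T^{\ge 0}=\{X\in D(A): \operatorname{Hom}_{D(A)}(T,X[i])=0\text{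 for all } i<0\}.$$ Then $$\mathcal D^{\le -n}\subseteq\mathcal T^{\le 0}\subseteq\mathcal D^{\le 0}\qquad\text{and}\qquad \mathcal D^{\ge 0}\subseteq\mathcal T^{\ge 0}\subseteq\mathcal D^{\ge -n}.$$ -/

import Mathlib

open CategoryTheory CategoryTheory.Limits

universe w u

namespace NTilting

variable {A : Type u} [Ring A]

/-- `T` admits a projective resolution `0 → Pₙ → ⋯ → P₁ → P₀ → T → 0` of length `n`. -/
def HasProjectiveResolutionOfLength (T : ModuleCat.{u} A) (n : ℕ) : Prop :=
  ∃ P : ProjectiveResolution T, ∀ i : ℕ, n < i → IsZero (P.complex.X i)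

/-- The direct sum `T^(Λ)` of copies of `T` indexed by the set `Λ`. -/
noncomputable abbrev copower (T : ModuleCat.{u} A) (Λ : Type u) : ModuleCat.{u} A :=
  ModuleCat.of A (Λ →₀ T)

variable [HasDerivedCategory.{w} (ModuleCat.{u} A)]

/-- `Hom_{D(A)}(T, X[i]) = 0`, the module `T` being seen as a complex in degree `0`. -/
def HomShiftVanishes (T : ModuleCat.{u} A) (X : DerivedCategory (ModuleCat.{u} A)) (i : ℤ) :
    Prop :=
  ∀ f : (DerivedCategory.singleFunctor (ModuleCat.{u} A) 0).obj T ⟶ X⟦i⟧, f = 0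

/-- `T` is a (not necessarily classical) `n`-tilting left `A`-module. -/
structure IsTilting (n : ℕ) (T : ModuleCat.{u} A) : Prop where
  /-- `T` has projective dimension at most `n`. -/
  projective_resolution : HasProjectiveResolutionOfLength T n
  /-- `Ext^i(T, T^(Λ)) = 0` for all `0 < i ≤ n` and all sets `Λ`. -/
  rigid : ∀ (Λ : Type u) (i : ℕ), 0 < i → i ≤ n →
    Subsingleton (Abelian.Ext.{u} T (copower T Λ) i)
  /-- `T` is a generator of the derived category. -/
  generator : ∀ X : DerivedCategory (ModuleCat.{u} A),
    (∀ i : ℤ, HomShiftVanishes T X i) → IsZero X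

/-- The aisle `𝒯^{≤ 0}`: all `X` with `Hom_{D(A)}(T, X[i]) = 0` for every `i > 0`. -/
def aisle (T : ModuleCat.{u} A) : ObjectProperty (DerivedCategory (ModuleCat.{u} A)) :=
  fun X => ∀ i : ℤ, 0 < i → HomShiftVanishes T X i

/-- The coaisle `𝒯^{≥ 0}`: all `X` with `Hom_{D(A)}(T, X[i]) = 0` for every `i < 0`. -/
def coaisle (T : ModuleCat.{u} A) : ObjectProperty (DerivedCategory (ModuleCat.{u} A)) :=
  fun X => ∀ i : ℤ, i < 0 → HomShiftVanishes T X i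

/-- `𝒟^{≤ k}`: all `X` with `H^i(X) = 0` for every `i > k`. -/
def naturalLE (A : Type u) [Ring A] [HasDerivedCategory.{w} (ModuleCat.{u} A)] (k : ℤ) :
    ObjectProperty (DerivedCategory (ModuleCat.{u} A)) :=
  DerivedCategory.TStructure.t.le k

/-- `𝒟^{≥ k}`: all `X` with `H^i(X) = 0` for every `i < k`. -/
def naturalGE (A : Type u) [Ring A] [HasDerivedCategory.{w} (ModuleCat.{u} A)] (k : ℤ) :
    ObjectProperty (DerivedCategory (ModuleCat.{u} A)) :=
  DerivedCategory.TStructure.t.ge k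

theorem naturalLE_iff (k : ℤ) (X : DerivedCategory (ModuleCat.{u} A)) :
    naturalLE A k X ↔
      ∀ i : ℤ, k < i → IsZero ((DerivedCategory.homologyFunctor (ModuleCat.{u} A) i).obj X) :=
  ⟨fun h => (DerivedCategory.isLE_iff X k).1 ⟨h⟩,
    fun h => ((DerivedCategory.isLE_iff X k).2 h).le⟩

theorem naturalGE_iff (k : ℤ) (X : DerivedCategory (ModuleCat.{u} A)) :
    naturalGE A k X ↔
      ∀ i : ℤ, i < k → IsZero ((DerivedCategory.homologyFunctor (ModuleCat.{u} A) i).obj X) :=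
  ⟨fun h => (DerivedCategory.isGE_iff X k).1 ⟨h⟩,
    fun h => ((DerivedCategory.isGE_iff X k).2 h).ge⟩

end NTilting

/-!
The inclusions `𝒟^{≤ -n} ⊆ 𝒯^{≤ 0}` and `𝒟^{≥ 0} ⊆ 𝒯^{≥ 0}` are direct. A bounded projective
resolution `P` of `T` is K-projective and concentrated in degrees `[-n, 0]`, so it has no nonzero
morphism to a complex with cohomology in degrees `< -n` (`homShiftVanishes_of_isLE`); and `T` lies
in `𝒟^{≤ 0}`, which is left orthogonal to `𝒟^{≥ 1}`.

The other two inclusions follow from these by taking orthogonals for the natural t-structure, once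
it is known that every morphism `X ⟶ Y` with `X` in `𝒯^{≤ 0}` and `Y` in `𝒯^{≥ 1}` is zero
(`IsTilting.hom_eq_zero`). To prove it, attach cells to `X`: put `X₀ = X`, and let `Xₖ₊₁` be the
mapping cone of the evaluation morphism to `Xₖ` from the direct sum of copies of `P[k]` indexed by
all morphisms of complexes `P[k] ⟶ Xₖ`. Each step kills `Hom(T, Xₖ[-k])`; since that direct sum is
`T^(Λ)[k]` in the derived category and `Ext^i(T, T^(Λ)) = 0` for all `i > 0`, no new morphisms
`T ⟶ Xₖ₊₁[i]` with `i > -k` appear (`IsTilting.homShiftVanishes_cellAttach`).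

Let `X_∞` be the colimit of the `Xₖ` in the category of complexes. The cone of `Xₖ ⟶ X_∞` lies in
`𝒟^{≤ -k}`, because exactness in a given degree passes to sequential colimits
(`exactAt_mappingCone_ι`). As `T` has finite projective dimension, `Hom(T, X_∞[i])` is controlled by
`Hom(T, Xₖ[i])` for large `k`, hence vanishes for every `i`; no compactness of `T` is needed. As `T`
is a generator, `X_∞` is zero in the derived category (`IsTilting.isZero_colimit_cellTower`).

Finally, a morphism of complexes `X ⟶ Y` with `Y` in `𝒯^{≥ 1}` becomes null-homotopic on all
the cells, so it extends strictly to every `Xₖ`, and thus factors through `X_∞`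
(`exists_extension_colimit_cellTower`).
-/

namespace NTilting

variable {A : Type u} [Ring A]

open Pretriangulated DerivedCategory

/-! ### Vanishing of morphisms out of `T` -/

section Vanishing

variable [HasDerivedCategory.{w} (ModuleCat.{u} A)] {T : ModuleCat.{u} A}
  {X Y : DerivedCategory (ModuleCat.{u} A)}

theorem HomShiftVanishes.of_iso {i : ℤ} (h : HomShiftVanishes T X i) (e : X ≅ Y) :
    HomShiftVanishes T Y i := fun f => by
  have h₁ := h (f ≫ (shiftFunctor _ i).map e.inv)
  rw [← cancel_mono ((shiftFunctor _ i).map e.inv), h₁, zero_comp]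

theorem homShiftVanishes_shift_iff (X : DerivedCategory (ModuleCat.{u} A)) {a b c : ℤ}
    (h : a + b = c) : HomShiftVanishes T (X⟦a⟧) b ↔ HomShiftVanishes T X c := by
  let e : X⟦c⟧ ≅ X⟦a⟧⟦b⟧ := (shiftFunctorAdd' _ a b c h).app X
  refine ⟨fun H f => ?_, fun H f => ?_⟩
  · rw [← cancel_mono e.hom, H (f ≫ e.hom), zero_comp]
  · rw [← cancel_mono e.inv, H (f ≫ e.inv), zero_comp]

/-- Morphisms into a shift of `X` are the same as morphisms out of the opposite shift of `T`. -/
theorem homShiftVanishes_iff_of_shift_source {i j : ℤ} (h : i + j = 0) :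
    HomShiftVanishes T X i ↔
      ∀ f : ((singleFunctor (ModuleCat.{u} A) 0).obj T)⟦j⟧ ⟶ X, f = 0 := by
  let T₀ := (singleFunctor (ModuleCat.{u} A) 0).obj T
  let eX : X⟦i⟧⟦j⟧ ≅ X := (shiftFunctorCompIsoId _ i j h).app X
  refine ⟨fun H f => ?_, fun H f => ?_⟩
  · obtain ⟨g, hg⟩ := (shiftFunctor _ j).map_surjective (f ≫ eX.inv : T₀⟦j⟧ ⟶ X⟦i⟧⟦j⟧)
    rw [← cancel_mono eX.inv, ← hg, H g, Functor.map_zero, zero_comp]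
  · have := H ((shiftFunctor _ j).map f ≫ eX.hom)
    apply (shiftFunctor _ j).map_injective
    rw [← cancel_mono eX.hom, this, Functor.map_zero, zero_comp]

/-- The part `Hom(T, X[i]) ⟶ Hom(T, Z[i]) ⟶ Hom(T, X[i + 1])` of the long exact sequence of a
distinguished triangle `X ⟶ Y ⟶ Z ⟶ X[1]`. -/
theorem HomShiftVanishes.obj₃ {D : Triangle (DerivedCategory (ModuleCat.{u} A))}
    (hD : D ∈ distTriang _) {i : ℤ} (h₂ : HomShiftVanishes T D.obj₂ i)
    (h₁ : HomShiftVanishes T D.obj₁ (i + 1)) : HomShiftVanishes T D.obj₃ i := by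
  rw [homShiftVanishes_iff_of_shift_source (add_neg_cancel i)] at h₂ ⊢
  intro f
  have h₁' := (homShiftVanishes_shift_iff D.obj₁ (add_comm 1 i)).2 h₁
  rw [homShiftVanishes_iff_of_shift_source (add_neg_cancel i)] at h₁'
  obtain ⟨g, rfl⟩ := Triangle.coyoneda_exact₃ D hD f (h₁' _)
  rw [h₂ g, zero_comp]

theorem HomShiftVanishes.obj₂ {D : Triangle (DerivedCategory (ModuleCat.{u} A))}
    (hD : D ∈ distTriang _) {i : ℤ} (h₁ : HomShiftVanishes T D.obj₁ i)
    (h₃ : HomShiftVanishes T D.obj₃ i) : HomShiftVanishes T D.obj₂ i := by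
  rw [homShiftVanishes_iff_of_shift_source (add_neg_cancel i)] at h₁ h₃ ⊢
  intro f
  obtain ⟨g, rfl⟩ := Triangle.coyoneda_exact₂ D hD f (h₃ _)
  rw [h₁ g, zero_comp]

end Vanishing

section KProjective

variable {C : Type*} [Category* C] [Abelian C] [HasDerivedCategory.{w} C]

/-- Morphisms in the derived category out of a K-projective complex are represented by morphisms
of complexes. -/
theorem Q_map_surjective_of_isKProjective (K L : CochainComplex C ℤ) [K.IsKProjective] :
    Function.Surjective (fun f : K ⟶ L => Q.map f) := by
  intro φ
  obtain ⟨g, hg⟩ := (CochainComplex.IsKProjective.Qh_map_bijective K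
    ((HomotopyCategory.quotient _ _).obj L)).surjective
      ((quotientCompQhIso C).hom.app K ≫ φ ≫ (quotientCompQhIso C).inv.app L)
  obtain ⟨f, rfl⟩ := (HomotopyCategory.quotient _ _).map_surjective g
  refine ⟨f, ?_⟩
  have := quotientCompQhIso_hom_naturality f
  rw [hg] at this
  simpa using this.symm

/-- A morphism out of a K-projective complex which vanishes in the derived category is homotopic
to zero. -/
theorem nonempty_homotopy_zero_of_Q_map_eq_zero {K L : CochainComplex C ℤ} [K.IsKProjective]
    (f : K ⟶ L) (hf : Q.map f = 0) : Nonempty (Homotopy f 0) := by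
  refine ⟨HomotopyCategory.homotopyOfEq _ _ ?_⟩
  apply (CochainComplex.IsKProjective.Qh_map_bijective K
    ((HomotopyCategory.quotient _ _).obj L)).injective
  have := quotientCompQhIso_hom_naturality f
  rw [hf, comp_zero, ← zero_comp (f := (quotientCompQhIso C).hom.app L), cancel_mono] at this
  rw [this]
  simp

end KProjective

section Resolution

variable [HasDerivedCategory.{w} (ModuleCat.{u} A)] {T : ModuleCat.{u} A}

/-- Shifts of `T` in the derived category are represented by shifts of a projective resolution. -/
noncomputable def resolutionShiftIso (R : ProjectiveResolution T) (k : ℤ) :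
    Q.obj (R.cochainComplex⟦k⟧) ≅ ((singleFunctor (ModuleCat.{u} A) 0).obj T)⟦k⟧ :=
  (Q.commShiftIso k).app _ ≪≫ (shiftFunctor _ k).mapIso (asIso (Q.map R.π') ≪≫
    (singleFunctorIsoCompQ (ModuleCat.{u} A) 0).symm.app T)

theorem homShiftVanishes_iff_resolution (R : ProjectiveResolution T)
    (X : DerivedCategory (ModuleCat.{u} A)) {i j : ℤ} (h : i + j = 0) :
    HomShiftVanishes T X i ↔ ∀ f : Q.obj (R.cochainComplex⟦j⟧) ⟶ X, f = 0 := by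
  rw [homShiftVanishes_iff_of_shift_source h]
  let e := resolutionShiftIso R j
  refine ⟨fun H f => ?_, fun H f => ?_⟩
  · rw [← cancel_epi e.inv, H (e.inv ≫ f), comp_zero]
  · rw [← cancel_epi e.hom, H (e.hom ≫ f), comp_zero]

/-- If `T` has projective dimension at most `n`, then a morphism from `T` to a complex whose
cohomology lies in degrees `< -n` is zero in the derived category. -/
theorem homShiftVanishes_of_isLE {n : ℕ} (hT : HasProjectiveResolutionOfLength T n)
    (X : DerivedCategory (ModuleCat.{u} A)) (m : ℤ) [hX : X.IsLE m] {i : ℤ} (hi : n + m < i) :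
    HomShiftVanishes T X i := by
  obtain ⟨R, hR⟩ := hT
  obtain ⟨K, hK, ⟨e⟩⟩ := X.exists_iso_Q_obj_of_isLE m
  suffices HomShiftVanishes T (Q.obj K) i from this.of_iso e.symm
  rw [homShiftVanishes_iff_resolution R _ (add_neg_cancel i)]
  intro f
  obtain ⟨g, rfl⟩ := Q_map_surjective_of_isKProjective _ _ f
  suffices g = 0 by simp [this]
  ext j : 1
  by_cases hj : m < j
  · exact (K.isZero_of_isStrictlyLE m j hj).eq_of_tgt _ _
  · refine IsZero.eq_of_src ?_ _ _
    obtain ⟨l, hl⟩ := Int.eq_ofNat_of_zero_le (show 0 ≤ i - j by lia)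
    exact (hR l (by lia)).of_iso (R.cochainComplexXIso (j + -i) l (by lia))

end Resolution

/-! ### Direct sums of copies of a module or a complex -/

section Copower

/-- The endofunctor `M ↦ M^(Λ)` of the category of modules. -/
noncomputable def copowerFunctor (A : Type u) [Ring A] (Λ : Type u) :
    ModuleCat.{u} A ⥤ ModuleCat.{u} A where
  obj M := copower M Λ
  map f := ModuleCat.ofHom (Finsupp.mapRange.linearMap f.hom)
  map_id M := by ext : 1; simp
  map_comp f g := by ext : 1; simp [Finsupp.mapRange.linearMap_comp]

variable {Λ : Type u}

instance : (copowerFunctor A Λ).Additive where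
  map_add {M N f g} := by
    ext : 1
    refine LinearMap.ext fun (x : Λ →₀ M) => Finsupp.ext fun i => rfl

/-- Direct sums of modules are exact: lifts are chosen componentwise. -/
instance : (copowerFunctor A Λ).PreservesHomology :=
  Functor.preservesHomology_of_map_exact _ fun S hS => by
    rw [ShortComplex.moduleCat_exact_iff] at hS ⊢
    intro (x : Λ →₀ S.X₂) (hx : Finsupp.mapRange.linearMap S.g.hom x = 0)
    choose! s hs using hS
    have hx' : ∀ i, S.g.hom (x i) = 0 := fun i => DFunLike.congr_fun hx i
    classical
    refine ⟨Finsupp.onFinset x.support (fun i => if x i = 0 then 0 else s (x i))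
      (fun i hi => by by_contra h; simp_all), ?_⟩
    refine Finsupp.ext fun i => ?_
    change S.f.hom (if x i = 0 then 0 else s (x i)) = x i
    split_ifs with h
    · simp [h]
    · exact hs _ (hx' i)

/-- The inclusion of the summand `M` of index `l` in `M^(Λ)`. -/
noncomputable def copowerι (M : ModuleCat.{u} A) (l : Λ) : M ⟶ (copowerFunctor A Λ).obj M :=
  ModuleCat.ofHom (Finsupp.lsingle l)

/-- The morphism `M^(Λ) ⟶ N` defined by a family of morphisms `M ⟶ N`. -/
noncomputable def copowerDesc {M N : ModuleCat.{u} A} (f : Λ → (M ⟶ N)) :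
    (copowerFunctor A Λ).obj M ⟶ N :=
  ModuleCat.ofHom (Finsupp.lsum ℕ fun l => (f l).hom)

@[simp]
theorem copowerι_desc {M N : ModuleCat.{u} A} (f : Λ → (M ⟶ N)) (l : Λ) :
    copowerι M l ≫ copowerDesc f = f l := by
  ext : 1
  exact LinearMap.ext fun x => Finsupp.sum_single_index (map_zero (f l).hom)

theorem copowerι_desc_assoc {M N P : ModuleCat.{u} A} (f : Λ → (M ⟶ N)) (l : Λ) (g : N ⟶ P) :
    copowerι M l ≫ copowerDesc f ≫ g = f l ≫ g := by
  rw [← Category.assoc, copowerι_desc]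

theorem copower_hom_ext {M N : ModuleCat.{u} A} {f g : (copowerFunctor A Λ).obj M ⟶ N}
    (h : ∀ l, copowerι M l ≫ f = copowerι M l ≫ g) : f = g := by
  ext : 1
  refine Finsupp.lhom_ext' fun l => ?_
  exact congrArg ModuleCat.Hom.hom (h l)

theorem copowerι_naturality {M N : ModuleCat.{u} A} (f : M ⟶ N) (l : Λ) :
    copowerι M l ≫ (copowerFunctor A Λ).map f = f ≫ copowerι N l := by
  ext : 1
  exact LinearMap.ext fun x => Finsupp.mapRange_single (hf := map_zero f.hom)

theorem copowerι_naturality_assoc {M N P : ModuleCat.{u} A} (f : M ⟶ N) (l : Λ)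
    (g : (copowerFunctor A Λ).obj N ⟶ P) :
    copowerι M l ≫ (copowerFunctor A Λ).map f ≫ g = f ≫ copowerι N l ≫ g := by
  rw [← Category.assoc, copowerι_naturality, Category.assoc]

/-- The direct sum `K^(Λ)` of copies of a complex `K`. -/
noncomputable abbrev complexCopower (K : CochainComplex (ModuleCat.{u} A) ℤ) (Λ : Type u) :
    CochainComplex (ModuleCat.{u} A) ℤ :=
  ((copowerFunctor A Λ).mapHomologicalComplex (ComplexShape.up ℤ)).obj K

variable {K L : CochainComplex (ModuleCat.{u} A) ℤ}

/-- The inclusion of the summand `K` of index `l` in `K^(Λ)`. -/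
noncomputable def complexCopowerι (K : CochainComplex (ModuleCat.{u} A) ℤ) (l : Λ) :
    K ⟶ complexCopower K Λ where
  f i := copowerι (K.X i) l
  comm' _ _ _ := copowerι_naturality _ _

/-- The morphism `K^(Λ) ⟶ L` defined by a family of morphisms `K ⟶ L`. -/
noncomputable def complexCopowerDesc (f : Λ → (K ⟶ L)) : complexCopower K Λ ⟶ L where
  f i := copowerDesc fun l => (f l).f i
  comm' i j _ := copower_hom_ext fun l => by
    exact (copowerι_desc_assoc _ _ _).trans (((f l).comm i j).trans
      ((copowerι_naturality_assoc _ _ _).trans (by rw [copowerι_desc])).symm)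

theorem complexCopowerι_desc (f : Λ → (K ⟶ L)) (l : Λ) :
    complexCopowerι K l ≫ complexCopowerDesc f = f l := by
  ext i : 1
  exact copowerι_desc _ _

/-- Null-homotopies on the summands add up to a null-homotopy on the direct sum. -/
theorem nonempty_homotopy_zero_of_complexCopower (f : complexCopower K Λ ⟶ L)
    (h : ∀ l, Nonempty (Homotopy (complexCopowerι K l ≫ f) 0)) : Nonempty (Homotopy f 0) := by
  let h' := fun l => (h l).some
  refine ⟨⟨fun i j => copowerDesc fun l => (h' l).hom i j, fun i j hij => ?_, fun i => ?_⟩⟩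
  · refine copower_hom_ext fun l => ?_
    rw [copowerι_desc, (h' l).zero i j hij]
    exact comp_zero.symm
  · refine copower_hom_ext fun l => ?_
    have := (h' l).comm i
    simp only [dNext, prevD, AddMonoidHom.mk'_apply, HomologicalComplex.zero_f, add_zero] at this ⊢
    refine this.trans (Eq.trans ?_ (Preadditive.comp_add ..).symm)
    refine congrArg₂ (· + ·) ?_ ?_
    · exact ((copowerι_naturality_assoc (K.d i _) l _).trans (by rw [copowerι_desc])).symm
    · exact (copowerι_desc_assoc (fun l => (h' l).hom i _) l _).symm

end Copower

/-! ### Attaching cells -/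

section CellAttachment

variable {T : ModuleCat.{u} A} (R : ProjectiveResolution T)

/-- The direct sum of copies of `P[k]`, for `P` a projective resolution of `T`, indexed by all
morphisms of complexes `P[k] ⟶ X`. -/
noncomputable abbrev cellSource (k : ℤ) (X : CochainComplex (ModuleCat.{u} A) ℤ) :
    CochainComplex (ModuleCat.{u} A) ℤ :=
  complexCopower (R.cochainComplex⟦k⟧) (R.cochainComplex⟦k⟧ ⟶ X)

/-- The evaluation morphism, equal to `f` on the summand indexed by `f : P[k] ⟶ X`. -/
noncomputable def cellMap (k : ℤ) (X : CochainComplex (ModuleCat.{u} A) ℤ) :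
    cellSource R k X ⟶ X :=
  complexCopowerDesc fun f => f

/-- The complex obtained from `X` by killing all morphisms `P[k] ⟶ X`. -/
noncomputable abbrev cellAttach (k : ℤ) (X : CochainComplex (ModuleCat.{u} A) ℤ) :
    CochainComplex (ModuleCat.{u} A) ℤ :=
  CochainComplex.mappingCone (cellMap R k X)

variable [HasDerivedCategory.{w} (ModuleCat.{u} A)]

/-- In the derived category, the direct sum `P[k]^(Λ)` is `T^(Λ)[k]`. -/
noncomputable def complexCopowerResolutionIso (k : ℤ) (Λ : Type u) :
    Q.obj (complexCopower (R.cochainComplex⟦k⟧) Λ) ≅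
      ((singleFunctor (ModuleCat.{u} A) 0).obj (copower T Λ))⟦k⟧ :=
  let G := (copowerFunctor A Λ).mapHomologicalComplex (ComplexShape.up ℤ)
  Q.mapIso ((G.commShiftIso k).app R.cochainComplex) ≪≫
    (Q.commShiftIso k).app (G.obj R.cochainComplex) ≪≫
    (shiftFunctor _ k).mapIso (asIso (Q.map (G.map R.π')) ≪≫
      Q.mapIso ((HomologicalComplex.singleMapHomologicalComplex (copowerFunctor A Λ)
        (ComplexShape.up ℤ) 0).app T) ≪≫
      (singleFunctorIsoCompQ (ModuleCat.{u} A) 0).symm.app (copower T Λ))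

theorem isLE_complexCopower (k : ℤ) (Λ : Type u) :
    (Q.obj (complexCopower (R.cochainComplex⟦k⟧) Λ)).IsLE (-k) := by
  have : (((singleFunctor (ModuleCat.{u} A) 0).obj (copower T Λ))⟦k⟧).IsLE (-k) :=
    TStructure.t.isLE_shift _ 0 k (-k)
  exact TStructure.t.isLE_of_iso (complexCopowerResolutionIso R k Λ).symm (-k)

/-- Above the range where rigidity is assumed, the vanishing comes from the projective dimension. -/
theorem IsTilting.homShiftVanishes_copower {n : ℕ} (hT : IsTilting n T) (Λ : Type u) {i : ℤ}
    (hi : 0 < i) :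
    HomShiftVanishes T ((singleFunctor (ModuleCat.{u} A) 0).obj (copower T Λ)) i := by
  by_cases hn : i ≤ n
  · lift i to ℕ using hi.le
    have := hT.rigid Λ i (by lia) (by lia)
    intro f
    exact (Abelian.Ext.homEquiv (X := T) (Y := copower T Λ) (n := i)).symm.subsingleton.elim f 0
  · exact homShiftVanishes_of_isLE hT.projective_resolution _ 0 (by lia)

theorem IsTilting.homShiftVanishes_complexCopower {n : ℕ} (hT : IsTilting n T) (k : ℤ)
    (Λ : Type u) {i : ℤ} (hi : -k < i) :
    HomShiftVanishes T (Q.obj (complexCopower (R.cochainComplex⟦k⟧) Λ)) i :=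
  ((homShiftVanishes_shift_iff _ rfl).2
    (hT.homShiftVanishes_copower Λ (i := k + i) (by lia))).of_iso
      (complexCopowerResolutionIso R k Λ).symm

/-- Every morphism `P[k] ⟶ X` vanishes after the attachment, since it factors through the evaluation
morphism by its own summand. -/
theorem Q_map_comp_inr_cellMap {k : ℤ} {X : CochainComplex (ModuleCat.{u} A) ℤ}
    (a : R.cochainComplex⟦k⟧ ⟶ X) :
    Q.map a ≫ Q.map (CochainComplex.mappingCone.inr (cellMap R k X)) = 0 := by
  have h₀ : Q.map (cellMap R k X) ≫ Q.map (CochainComplex.mappingCone.inr (cellMap R k X)) = 0 :=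
    comp_distTriang_mor_zero₁₂ _ (mappingCone_triangle_distinguished (cellMap R k X))
  have ha : complexCopowerι _ a ≫ cellMap R k X = a := complexCopowerι_desc (fun f => f) a
  rw [← congrArg Q.map ha, Q.map_comp, Category.assoc, h₀, comp_zero]

/-- Attaching cells in degree `-k` kills `Hom(T, X[-k])`, and keeps the vanishing of
`Hom(T, X[i])` for `i > -k` since `T` is rigid. -/
theorem IsTilting.homShiftVanishes_cellAttach {n : ℕ} (hT : IsTilting n T) {k : ℤ}
    {X : CochainComplex (ModuleCat.{u} A) ℤ}
    (hX : ∀ i, -k < i → HomShiftVanishes T (Q.obj X) i) (i : ℤ) (hi : -(k + 1) < i) :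
    HomShiftVanishes T (Q.obj (cellAttach R k X)) i := by
  have hD := mappingCone_triangle_distinguished (cellMap R k X)
  by_cases hi' : -k < i
  · exact HomShiftVanishes.obj₃ hD (hX i hi')
      (hT.homShiftVanishes_complexCopower R k _ (i := i + 1) (by lia))
  obtain rfl : i = -k := by lia
  have h₁ : HomShiftVanishes T ((Q.obj (cellSource R k X))⟦(1 : ℤ)⟧) (-k) :=
    (homShiftVanishes_shift_iff _ rfl).2 (hT.homShiftVanishes_complexCopower R k _ (by lia))
  rw [homShiftVanishes_iff_resolution R _ (neg_add_cancel k)] at h₁ ⊢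
  intro f
  obtain ⟨g, hg⟩ := Triangle.coyoneda_exact₃ _ hD f (h₁ _)
  obtain ⟨a, rfl⟩ := Q_map_surjective_of_isKProjective _ _ g
  rw [hg]
  exact Q_map_comp_inr_cellMap R a

/-- The cone of `X ⟶ X'`, for `X'` obtained by attaching cells in degree `-k`, is `T^(Λ)[k + 1]`. -/
theorem trW_le_inr_cellMap (k : ℤ) (X : CochainComplex (ModuleCat.{u} A) ℤ) :
    (TStructure.t.le (-k)).trW (Q.map (CochainComplex.mappingCone.inr (cellMap R k X))) := by
  have hD := rot_of_distTriang _ (mappingCone_triangle_distinguished (cellMap R k X))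
  refine ObjectProperty.trW.mk _ hD ?_
  have := isLE_complexCopower R k (R.cochainComplex⟦k⟧ ⟶ X)
  have h : ((Q.obj (cellSource R k X))⟦(1 : ℤ)⟧).IsLE (-k) := by
    have := TStructure.t.isLE_shift (Q.obj (cellSource R k X)) (-k) 1 (-k - 1)
    exact TStructure.t.isLE_of_le _ (-k - 1) (-k)
  exact h.le

/-- A morphism `X ⟶ Y` extends along the attachment of cells in degree `-k` as soon as
`Hom(T, Y[-k])` vanishes. -/
theorem exists_extension_cellAttach {k : ℤ} {X Y : CochainComplex (ModuleCat.{u} A) ℤ}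
    (hY : HomShiftVanishes T (Q.obj Y) (-k)) (g : X ⟶ Y) :
    ∃ g' : cellAttach R k X ⟶ Y, CochainComplex.mappingCone.inr (cellMap R k X) ≫ g' = g := by
  rw [homShiftVanishes_iff_resolution R _ (neg_add_cancel k)] at hY
  obtain ⟨h⟩ := nonempty_homotopy_zero_of_complexCopower (cellMap R k X ≫ g)
    fun l => nonempty_homotopy_zero_of_Q_map_eq_zero _ (hY _)
  obtain ⟨z, hz⟩ := CochainComplex.HomComplex.Cochain.equivHomotopy _ _ h
  refine ⟨CochainComplex.mappingCone.desc _ z g (by rw [hz]; simp), by simp⟩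

end CellAttachment

/-! ### Sequential colimits and the tower of cell attachments -/

section Colimit

open HomologicalComplex CochainComplex.HomComplex

theorem mappingCone_map_f_fst {K₁ L₁ K₂ L₂ : CochainComplex (ModuleCat.{u} A) ℤ} (φ₁ : K₁ ⟶ L₁)
    (φ₂ : K₂ ⟶ L₂) (a : K₁ ⟶ K₂) (b : L₁ ⟶ L₂) (comm : φ₁ ≫ b = a ≫ φ₂) (p q : ℤ)
    (h : p + 1 = q) :
    (CochainComplex.mappingCone.map φ₁ φ₂ a b comm).f p ≫
      (CochainComplex.mappingCone.fst φ₂).1.v p q h =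
        (CochainComplex.mappingCone.fst φ₁).1.v p q h ≫ a.f q := by
  rw [CochainComplex.mappingCone.ext_from_iff φ₁ q p h]
  simp [CochainComplex.mappingCone.map]

theorem mappingCone_map_f_snd {K₁ L₁ K₂ L₂ : CochainComplex (ModuleCat.{u} A) ℤ} (φ₁ : K₁ ⟶ L₁)
    (φ₂ : K₂ ⟶ L₂) (a : K₁ ⟶ K₂) (b : L₁ ⟶ L₂) (comm : φ₁ ≫ b = a ≫ φ₂) (p : ℤ) :
    (CochainComplex.mappingCone.map φ₁ φ₂ a b comm).f p ≫
      (CochainComplex.mappingCone.snd φ₂).v p p (add_zero p) =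
        (CochainComplex.mappingCone.snd φ₁).v p p (add_zero p) ≫ b.f p := by
  rw [CochainComplex.mappingCone.ext_from_iff φ₁ (p + 1) p rfl]
  simp [CochainComplex.mappingCone.map]

theorem mappingCone_ext {K L : CochainComplex (ModuleCat.{u} A) ℤ} (φ : K ⟶ L) {p q : ℤ}
    (h : p + 1 = q) {x y : (CochainComplex.mappingCone φ).X p}
    (h₁ : (CochainComplex.mappingCone.fst φ).1.v p q h x =
      (CochainComplex.mappingCone.fst φ).1.v p q h y)
    (h₂ : (CochainComplex.mappingCone.snd φ).v p p (add_zero p) x =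
      (CochainComplex.mappingCone.snd φ).v p p (add_zero p) y) : x = y := by
  have e := CochainComplex.mappingCone.id_X φ p q h
  refine (ConcreteCategory.congr_hom e x).symm.trans (Eq.trans ?_ (ConcreteCategory.congr_hom e y))
  exact congrArg₂ (· + ·)
    (congrArg ((CochainComplex.mappingCone.inl φ).v q p (by lia)) h₁)
    (congrArg ((CochainComplex.mappingCone.inr φ).f p) h₂)

section

variable {F : ℕ ⥤ CochainComplex (ModuleCat.{u} A) ℤ} {c : Cocone F}

/-- Elements of a sequential colimit come from arbitrarily late stages. -/
theorem exists_rep_of_isColimit (hc : IsColimit c) (k : ℕ) (j : ℤ) (x : c.pt.X j) :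
    ∃ (m : ℕ) (_ : k ≤ m) (b : (F.obj m).X j), (c.ι.app m).f j b = x := by
  have : PreservesFilteredColimitsOfSize.{0, 0} (forget (ModuleCat.{u} A)) :=
    preservesFilteredColimitsOfSize_shrink.{0, u, 0, u} _
  obtain ⟨m, b, hb⟩ := Concrete.isColimit_exists_rep _
    (isColimitOfPreserves (eval (ModuleCat.{u} A) (ComplexShape.up ℤ) j) hc) x
  refine ⟨max k m, le_max_left k m, (F.map (homOfLE (le_max_right k m))).f j b, ?_⟩
  refine Eq.trans ?_ hb
  exact ConcreteCategory.congr_hom (congr_hom (c.w (homOfLE (le_max_right k m))) j) b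

theorem exists_map_eq_zero_of_isColimit (hc : IsColimit c) (m : ℕ) (j : ℤ) (b : (F.obj m).X j)
    (hb : (c.ι.app m).f j b = 0) : ∃ (l : ℕ) (h : m ≤ l), (F.map (homOfLE h)).f j b = 0 := by
  have : PreservesFilteredColimitsOfSize.{0, 0} (forget (ModuleCat.{u} A)) :=
    preservesFilteredColimitsOfSize_shrink.{0, u, 0, u} _
  have hcj := isColimitOfPreserves (eval (ModuleCat.{u} A) (ComplexShape.up ℤ) j) hc
  obtain ⟨l, f, hl⟩ := (IsColimit.eq_iff' hcj (i := m) b (0 : (F.obj m).X j)).1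
    (hb.trans (map_zero ((c.ι.app m).f j).hom).symm)
  exact ⟨l, leOfHom f, hl.trans (map_zero ((F.map f).f j).hom)⟩

end

/-- Exactness of the mapping cone passes to sequential colimits: a cycle of the cone of
`F.obj k ⟶ colim F` comes from a cycle of the cone of `F.obj k ⟶ F.obj m` for some `m`,
where it is a boundary. -/
theorem exactAt_mappingCone_ι (F : ℕ ⥤ CochainComplex (ModuleCat.{u} A) ℤ) (c : Cocone F)
    (hc : IsColimit c) (k : ℕ) (i : ℤ)
    (hF : ∀ (m : ℕ) (h : k ≤ m), (CochainComplex.mappingCone (F.map (homOfLE h))).ExactAt i) :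
    (CochainComplex.mappingCone (c.ι.app k)).ExactAt i := by
  let ψ (m : ℕ) (h : k ≤ m) : CochainComplex.mappingCone (F.map (homOfLE h)) ⟶
      CochainComplex.mappingCone (c.ι.app k) :=
    CochainComplex.mappingCone.map _ _ (𝟙 _) (c.ι.app m) (by simp)
  let τ (m l : ℕ) (h : k ≤ m) (hml : m ≤ l) : CochainComplex.mappingCone (F.map (homOfLE h)) ⟶
      CochainComplex.mappingCone (F.map (homOfLE (h.trans hml))) :=
    CochainComplex.mappingCone.map _ _ (𝟙 _) (F.map (homOfLE hml)) (by
      rw [← F.map_comp, homOfLE_comp, Category.id_comp])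
  have hτψ (m l : ℕ) (h : k ≤ m) (hml : m ≤ l) : τ m l h hml ≫ ψ l (h.trans hml) = ψ m h := by
    dsimp only [τ, ψ]
    rw [← CochainComplex.mappingCone.map_comp]
    simp
  -- an element of the cone of the colimit comes from a finite stage
  have h₁ (j : ℤ) (z : (CochainComplex.mappingCone (c.ι.app k)).X j) :
      ∃ (m : ℕ) (h : k ≤ m) (w : (CochainComplex.mappingCone (F.map (homOfLE h))).X j),
        (ψ m h).f j w = z := by
    obtain ⟨m, h, b, hb⟩ := exists_rep_of_isColimit hc k j
      ((CochainComplex.mappingCone.snd (c.ι.app k)).v j j (add_zero j) z)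
    refine ⟨m, h, (CochainComplex.mappingCone.inl (F.map (homOfLE h))).v (j + 1) j (by lia)
      ((CochainComplex.mappingCone.fst (c.ι.app k)).1.v j (j + 1) rfl z) +
      (CochainComplex.mappingCone.inr (F.map (homOfLE h))).f j b, ?_⟩
    have e₁ : (CochainComplex.mappingCone.inl (F.map (homOfLE h))).v (j + 1) j (by lia) ≫
        (ψ m h).f j = (CochainComplex.mappingCone.inl (c.ι.app k)).v (j + 1) j (by lia) := by
      simp [ψ, CochainComplex.mappingCone.map]
    have e₂ : (CochainComplex.mappingCone.inr (F.map (homOfLE h))).f j ≫ (ψ m h).f j =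
        (c.ι.app m).f j ≫ (CochainComplex.mappingCone.inr (c.ι.app k)).f j := by
      simp [ψ, CochainComplex.mappingCone.map]
    have e₃ := CochainComplex.mappingCone.id_X (c.ι.app k) j (j + 1) rfl
    refine (map_add ((ψ m h).f j).hom _ _).trans
      (Eq.trans ?_ (ConcreteCategory.congr_hom e₃ z))
    refine congrArg₂ (· + ·) (ConcreteCategory.congr_hom e₁ _) ?_
    exact (ConcreteCategory.congr_hom e₂ b).trans
      (congrArg ((CochainComplex.mappingCone.inr (c.ι.app k)).f j) hb)
  -- an element of a finite stage which becomes zero in the colimit does so at a finite stage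
  have h₂ (j : ℤ) (m : ℕ) (h : k ≤ m) (w : (CochainComplex.mappingCone (F.map (homOfLE h))).X j)
      (hw : (ψ m h).f j w = 0) : ∃ (l : ℕ) (hl : m ≤ l), (τ m l h hl).f j w = 0 := by
    have hw₁ : (CochainComplex.mappingCone.fst (F.map (homOfLE h))).1.v j (j + 1) rfl w = 0 :=
      (ConcreteCategory.congr_hom (mappingCone_map_f_fst _ (c.ι.app k) (𝟙 _) (c.ι.app m) _ j _
        rfl) w).symm.trans ((congrArg
          ((CochainComplex.mappingCone.fst (c.ι.app k)).1.v j (j + 1) rfl) hw).trans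
            (map_zero (ModuleCat.Hom.hom _)))
    have hw₂ : (c.ι.app m).f j
        ((CochainComplex.mappingCone.snd (F.map (homOfLE h))).v j j (add_zero j) w) = 0 :=
      (ConcreteCategory.congr_hom (mappingCone_map_f_snd _ (c.ι.app k) (𝟙 _) (c.ι.app m) _ j)
        w).symm.trans ((congrArg
          ((CochainComplex.mappingCone.snd (c.ι.app k)).v j j (add_zero j)) hw).trans
            (map_zero (ModuleCat.Hom.hom _)))
    obtain ⟨l, hl, hb⟩ := exists_map_eq_zero_of_isColimit hc m j _ hw₂
    refine ⟨l, hl, mappingCone_ext _ rfl ?_ ?_⟩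
    · exact (ConcreteCategory.congr_hom (mappingCone_map_f_fst _ _ (𝟙 _) (F.map (homOfLE hl)) _ j
        _ rfl) w).trans (hw₁.trans (map_zero (ModuleCat.Hom.hom _)).symm)
    · exact (ConcreteCategory.congr_hom (mappingCone_map_f_snd _ _ (𝟙 _) (F.map (homOfLE hl)) _ j)
        w).trans (hb.trans (map_zero (ModuleCat.Hom.hom _)).symm)
  rw [HomologicalComplex.exactAt_iff' _ (i - 1) i (i + 1) (by simp) (by simp),
    ShortComplex.moduleCat_exact_iff]
  intro z hz
  obtain ⟨m, h, w, rfl⟩ := h₁ i z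
  obtain ⟨l, hl, hw⟩ := h₂ (i + 1) m h
    ((CochainComplex.mappingCone (F.map (homOfLE h))).d i (i + 1) w) (by
      rw [← ConcreteCategory.comp_apply, ← Hom.comm, ConcreteCategory.comp_apply]
      exact hz)
  have := hF l (h.trans hl)
  rw [HomologicalComplex.exactAt_iff' _ (i - 1) i (i + 1) (by simp) (by simp),
    ShortComplex.moduleCat_exact_iff] at this
  obtain ⟨v, hv⟩ := this ((τ m l h hl).f i w) (by
    rw [← ConcreteCategory.comp_apply, ← Hom.comm, ConcreteCategory.comp_apply] at hw
    exact hw)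
  refine ⟨(ψ l (h.trans hl)).f (i - 1) v, ?_⟩
  have e₁ : (CochainComplex.mappingCone (F.map (homOfLE (h.trans hl)))).d (i - 1) i ≫
      (ψ l (h.trans hl)).f i = (ψ l (h.trans hl)).f (i - 1) ≫
        (CochainComplex.mappingCone (c.ι.app k)).d (i - 1) i := (Hom.comm _ _ _).symm
  have e₂ : (τ m l h hl).f i ≫ (ψ l (h.trans hl)).f i = (ψ m h).f i := by
    rw [← comp_f, hτψ]
  refine (ConcreteCategory.congr_hom e₁ v).symm.trans ?_
  refine Eq.trans ?_ (ConcreteCategory.congr_hom e₂ w)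
  exact congrArg ((ψ l (h.trans hl)).f i) hv

end Colimit

section Tower

variable {T : ModuleCat.{u} A} (R : ProjectiveResolution T)
  (X : CochainComplex (ModuleCat.{u} A) ℤ)

/-- The sequence of complexes obtained from `X` by attaching, in the `k`-th step, cells in
degree `-k`. -/
noncomputable def cellTower : ℕ → CochainComplex (ModuleCat.{u} A) ℤ
  | 0 => X
  | k + 1 => cellAttach R k (cellTower k)

/-- The inclusion of each stage of the tower in the next one. -/
noncomputable def cellTowerMap (k : ℕ) : cellTower R X k ⟶ cellTower R X (k + 1) :=
  CochainComplex.mappingCone.inr (cellMap R k (cellTower R X k))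

/-- The tower of cell attachments, as a functor. -/
noncomputable abbrev cellTowerFunctor : ℕ ⥤ CochainComplex (ModuleCat.{u} A) ℤ :=
  Functor.ofSequence (cellTowerMap R X)

/-- The morphism from `X`, the initial stage of the tower, to the colimit. -/
noncomputable def cellTowerι : X ⟶ colimit (cellTowerFunctor R X) :=
  colimit.ι (cellTowerFunctor R X) 0

variable {X} [HasDerivedCategory.{w} (ModuleCat.{u} A)]

/-- The `k`-th stage lies in `𝒯^{≤ -k}`. -/
theorem IsTilting.homShiftVanishes_cellTower {n : ℕ} (hT : IsTilting n T)
    (hX : aisle T (Q.obj X)) (k : ℕ) :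
    ∀ i : ℤ, -(k : ℤ) < i → HomShiftVanishes T (Q.obj (cellTower R X k)) i := by
  induction k with
  | zero => exact fun i hi => hX i (by simpa using hi)
  | succ k hk => exact hT.homShiftVanishes_cellAttach R hk

/-- Morphisms whose cone lies in `𝒟^{≤ m}` compose, by the octahedral axiom. -/
theorem trW_le_comp {X Y Z : DerivedCategory (ModuleCat.{u} A)} {f : X ⟶ Y} {g : Y ⟶ Z} {m : ℤ}
    (hf : (TStructure.t.le m).trW f) (hg : (TStructure.t.le m).trW g) :
    (TStructure.t.le m).trW (f ≫ g) := by
  obtain ⟨Z₁₂, v₁₂, w₁₂, H₁₂, mem₁₂⟩ := hf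
  obtain ⟨Z₂₃, v₂₃, w₂₃, H₂₃, mem₂₃⟩ := hg
  obtain ⟨Z₁₃, v₁₃, w₁₂, H₁₃⟩ := distinguished_cocone_triangle (f ≫ g)
  exact ⟨_, _, _, H₁₃, (TStructure.t.isLE₂ _ (Triangulated.someOctahedron rfl H₁₂ H₂₃ H₁₃).mem m
    ⟨mem₁₂⟩ ⟨mem₂₃⟩).le⟩

variable (X) in
/-- The cells attached from the `k`-th stage on lie in `𝒟^{≤ -k}`, and so do the cones of the resulting
morphisms. -/
theorem trW_le_cellTowerFunctor_map (k m : ℕ) (h : k ≤ m) :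
    (TStructure.t.le (-k)).trW (Q.map ((cellTowerFunctor R X).map (homOfLE h))) := by
  induction m, h using Nat.le_induction with
  | base =>
    rw [Subsingleton.elim (homOfLE (le_refl k)) (𝟙 k), CategoryTheory.Functor.map_id,
      CategoryTheory.Functor.map_id]
    refine ⟨_, _, _, contractible_distinguished _, ?_⟩
    exact (naturalLE_iff _ _).2 fun i _ => Functor.map_isZero _ (isZero_zero _)
  | succ m h hm =>
    rw [← homOfLE_comp h (Nat.le_succ m), Functor.map_comp, Functor.map_comp]
    refine trW_le_comp hm ?_
    rw [Functor.ofSequence_map_homOfLE_succ (cellTowerMap R X) m]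
    exact ObjectProperty.trW_monotone (TStructure.t.le_monotone (by lia)) _
      (trW_le_inr_cellMap R m (cellTower R X m))

variable (X) in
/-- The cone of the morphism from the `k`-th stage to the colimit lies in `𝒟^{≤ -k}`. -/
theorem isLE_mappingCone_cellTower_ι (k : ℕ) :
    (Q.obj (CochainComplex.mappingCone (colimit.ι (cellTowerFunctor R X) k))).IsLE (-k) := by
  rw [isLE_Q_obj_iff, CochainComplex.isLE_iff]
  intro i hi
  refine exactAt_mappingCone_ι (cellTowerFunctor R X) _ (colimit.isColimit _) k i fun m h => ?_
  have := ((TStructure.t.le (-k)).trW_iff_of_distinguished _ (mappingCone_triangle_distinguished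
    ((cellTowerFunctor R X).map (homOfLE h)))).1 (trW_le_cellTowerFunctor_map R X k m h)
  have h' : (Q.obj (CochainComplex.mappingCone
    ((cellTowerFunctor R X).map (homOfLE h)))).IsLE (-k) := ⟨this⟩
  rw [isLE_Q_obj_iff, CochainComplex.isLE_iff] at h'
  exact h' i hi

/-- The colimit is right orthogonal to all shifts of `T`: in any given degree, it is so close to a
late stage of the tower that the finite projective dimension of `T` applies to the difference. -/
theorem IsTilting.isZero_colimit_cellTower {n : ℕ} (hT : IsTilting n T)
    (hX : aisle T (Q.obj X)) : IsZero (Q.obj (colimit (cellTowerFunctor R X))) := by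
  refine hT.generator _ fun i => ?_
  obtain ⟨k, hk⟩ : ∃ k : ℕ, n + -(k : ℤ) < i := ⟨n + i.natAbs + 1, by lia⟩
  have := isLE_mappingCone_cellTower_ι R X k
  exact HomShiftVanishes.obj₂
    (mappingCone_triangle_distinguished (colimit.ι (cellTowerFunctor R X) k))
    (hT.homShiftVanishes_cellTower R hX k i (by lia))
    (homShiftVanishes_of_isLE hT.projective_resolution _ (-k) (hX := this) hk)

variable (X) in
/-- A morphism `X ⟶ Y` extends successively to all stages of the tower. -/
theorem exists_extension_colimit_cellTower {Y : CochainComplex (ModuleCat.{u} A) ℤ}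
    (hY : ∀ i : ℤ, i ≤ 0 → HomShiftVanishes T (Q.obj Y) i) (g : X ⟶ Y) :
    ∃ g' : colimit (cellTowerFunctor R X) ⟶ Y, cellTowerι R X ≫ g' = g := by
  choose e he using fun k : ℕ => exists_extension_cellAttach R (k := k)
    (X := cellTower R X k) (hY (-k) (by lia))
  let a : ∀ k, cellTower R X k ⟶ Y := fun k => Nat.rec g (fun k b => e k b) k
  have ha (k : ℕ) : cellTowerMap R X k ≫ a (k + 1) = a k := he k (a k)
  let c : Cocone (cellTowerFunctor R X) := ⟨Y, NatTrans.ofSequence a fun k => by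
    rw [Functor.ofSequence_map_homOfLE_succ]
    exact (ha k).trans (Category.comp_id (a k)).symm⟩
  exact ⟨colimit.desc _ c, colimit.ι_desc c 0⟩

end Tower

variable [HasDerivedCategory.{w} (ModuleCat.{u} A)]

/-- The aisle `𝒯^{≤ 0}` is left orthogonal to `𝒯^{≥ 1}`. -/
theorem IsTilting.hom_eq_zero {n : ℕ} {T : ModuleCat.{u} A} (hT : IsTilting n T)
    {X Y : DerivedCategory (ModuleCat.{u} A)} (hX : aisle T X)
    (hY : ∀ i : ℤ, i ≤ 0 → HomShiftVanishes T Y i) (f : X ⟶ Y) : f = 0 := by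
  obtain ⟨R, -⟩ := hT.projective_resolution
  let eX := Q.objObjPreimageIso X
  let eY := Q.objObjPreimageIso Y
  obtain ⟨Y', g, s, _, hg⟩ := left_fac (eX.hom ≫ f ≫ eY.inv)
  obtain ⟨g', rfl⟩ := exists_extension_colimit_cellTower R _
    (fun i hi => (hY i hi).of_iso (eY.symm ≪≫ asIso (Q.map s))) g
  -- the morphism factors through the colimit of the tower, which is zero in the derived category
  have hZ := hT.isZero_colimit_cellTower R fun i hi => (hX i hi).of_iso eX.symm
  rw [Functor.map_comp, hZ.eq_zero_of_src (Q.map g'), comp_zero, zero_comp] at hg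
  rw [← cancel_epi eX.hom, ← cancel_mono eY.inv, Category.assoc, hg, comp_zero, zero_comp]

end NTilting

theorem mainTheorem3 {A : Type u} [Ring A] [HasDerivedCategory.{w} (ModuleCat.{u} A)]
    (n : ℕ) (T : ModuleCat.{u} A) (hT : NTilting.IsTilting n T) :
    (NTilting.naturalLE A (-(n : ℤ)) ≤ NTilting.aisle T ∧
      NTilting.aisle T ≤ NTilting.naturalLE A 0) ∧
    (NTilting.naturalGE A 0 ≤ NTilting.coaisle T ∧
      NTilting.coaisle T ≤ NTilting.naturalGE A (-(n : ℤ))) := by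
  open NTilting DerivedCategory in
  have h₁ : naturalLE A (-(n : ℤ)) ≤ aisle T := fun X hX i hi =>
    haveI : X.IsLE (-(n : ℤ)) := ⟨hX⟩
    homShiftVanishes_of_isLE hT.projective_resolution X (-(n : ℤ)) (by lia)
  have h₂ : naturalGE A 0 ≤ coaisle T := fun X hX i hi f => by
    have : X.IsGE 0 := ⟨hX⟩
    have : (X⟦i⟧).IsGE 1 := by
      have := TStructure.t.isGE_shift X 0 i (-i)
      exact TStructure.t.isGE_of_ge _ 1 (-i)
    exact TStructure.t.zero f 0 1
  refine ⟨⟨h₁, fun X hX => ?_⟩, h₂, fun Y hY => ?_⟩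
  -- `𝒟^{≤ 0}` is the left orthogonal of `𝒟^{≥ 1}`, which lies in `𝒯^{≥ 1}`
  · refine ((TStructure.t.isLE_iff_orthogonal 0 1 rfl X).2 fun Y f hY => ?_).le
    refine hT.hom_eq_zero hX (fun i hi => ?_) f
    rw [← homShiftVanishes_shift_iff Y (show (1 : ℤ) + (i - 1) = i by lia)]
    exact h₂ _ (TStructure.t.isGE_shift Y 1 1 0).ge (i - 1) (by lia)
  -- `𝒟^{≥ -n}` is the right orthogonal of `𝒟^{≤ -n - 1}`, whose shift by `-1` lies in `𝒯^{≤ 0}`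
  · refine ((TStructure.t.isGE_iff_orthogonal (-n - 1) (-n) (by lia) Y).2 fun Z f hZ => ?_).ge
    apply (shiftFunctor _ (-1 : ℤ)).map_injective
    rw [Functor.map_zero]
    refine hT.hom_eq_zero (h₁ _ (TStructure.t.isLE_shift Z (-n - 1) (-1) (-n)).le)
      (fun i hi => ?_) _
    exact (homShiftVanishes_shift_iff Y (show (-1 : ℤ) + i = i - 1 by lia)).2 (hY _ (by lia))
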